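/- All rings are associative with unit. For a regular cardinal $\kappa$, a poset is $\kappa$-directed if each of its subsets of cardinality less than $\kappa$ has an upper bound; a $\kappa$-directed colimit is a colimit of a diagram indexed by a $\kappa$-directed poset, and "directed" means $\aleph_0$-directed. An object $X$ of a category with $\kappa$-directed colimits is $\kappa$-presentable if $\operatorname{Hom}(X,-)$ preserves $\kappa$-directed colimits; finitely (countably) presentable means $\aleph_0$-presentable ($\aleph_1$-presentable). A category is $\kappa$-accessible if it has $\kappa$-directed colimits and there is a set of $\kappa$-presentable objects such that every object is a $\kappa$-directed colimit of objects from this set. For a class $\mathcal S$ of right $R$-modules, $\varinjlim\mathcal S$ denotes the class of all directed colimits of modules from $\mathcal S$ in the category $\mathrm{Mod}\text{-}R$ of right $R$-modules. Let $R$ be a right countably coherent ring, i.e., a ring in which every finitely generated right ideal is countably presentable as a right $R$-module. Let $(\mathcal S_n)_{n\in\mathbb Z}$ be a sequence of sets of finitely presentable right $R$-modules. Let $\mathsf C$ be the full subcategory of the category of (unbounded) cochain complexes of right $R$-modules formed by the acyclic complexes $C^\bullet$ with $C^n\in\varinjlim\mathcal S_n$ for every $n\in\mathbb Z$. Then: 1.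 the category $\mathsf C$ is $\aleph_1$-accessible; 2. an object $T^\bullet\in\mathsf C$ is $\aleph_1$-presentable in $\mathsf C$ if and only if, for every $n\in\mathbb Z$, the right $R$-module $T^n$ is countably presentable; 3. consequently, every complex $C^\bullet\in\mathsf C$ is an $\aleph_1$-directed colimit, in the category of complexes of right $R$-modules, of complexes $T^\bullet\in\mathsf C$ all of whose terms $T^n$ are countably presentable right $R$-modules. -/

import Mathlib

universe w v u

open CategoryTheory

namespace AcyclicLim

instance fact_isRegular_aleph_one : Fact (Cardinal.aleph.{w} 1).IsRegular :=
  ⟨Cardinal.isRegular_aleph_one⟩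

/-- `ℵ₁`-presentable objects of a category. -/
abbrev IsCountablyPresentable {C : Type u} [Category.{v} C] (X : C) : Prop :=
  IsCardinalPresentable X (Cardinal.aleph.{w} 1)

/-- A poset is `κ`-directed if every subset of cardinality less than `κ` has an upper bound
(for `κ` infinite such a poset is nonempty, since the empty subset has an upper bound). -/
def IsDirectedPoset (κ : Cardinal.{w}) (J : Type w) [PartialOrder J] : Prop :=
  ∀ s : Set J, Cardinal.mk s < κ → BddAbove s

/-- The class of all colimits in `C` of diagrams of objects from `P`
indexed by (small) `κ`-directed posets. -/
def directedColimits (κ : Cardinal.{w}) {C : Type u} [Category.{v} C]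
    (P : ObjectProperty C) : ObjectProperty C :=
  fun X => ∃ (J : Type w) (_ : PartialOrder J), IsDirectedPoset κ J ∧ P.colimitsOfShape J X

/-- A ring `R` is right countably coherent if every finitely generated right ideal of `R` is
countably presentable as a right `R`-module. Right `R`-modules are modules over `Rᵐᵒᵖ`. -/
def IsRightCountablyCoherent (R : Type u) [Ring R] : Prop :=
  ∀ I : Submodule Rᵐᵒᵖ R, I.FG →
    IsCountablyPresentable.{u} (ModuleCat.of.{u} Rᵐᵒᵖ I)

/-- The acyclic complexes of right `R`-modules `K` such that, for every `n`, the term `K.X n` is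
a directed colimit of modules from `S n`. -/
def acyclicWithTermsInLim {R : Type u} [Ring R] (S : ℤ → ObjectProperty (ModuleCat.{u} Rᵐᵒᵖ)) :
    ObjectProperty (CochainComplex (ModuleCat.{u} Rᵐᵒᵖ) ℤ) :=
  fun K => K.Acyclic ∧ ∀ n : ℤ, directedColimits Cardinal.aleph0.{u} (S n) (K.X n)

end AcyclicLim

/-! The class `acyclicInLim S` is closed under filtered colimits of complexes, and complexes form a
locally `κ`-presentable category for every regular `κ`. Everything then rests on one factorization,
`exists_factor_acyclicInLim`: a morphism from a countably presentable complex `E` to a member `C` of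
the class factors through a countably presentable member. Hence these members over `C` are cofinal
among all countably presentable complexes over `C`, and `C` is their `ℵ₁`-filtered colimit
(`exists_colimitsOfShape_of_factor`).

The factorization is a small object argument of length `ω`. `exists_step` enlarges `E` over `C`, by
pushouts along maps of contractible two-term complexes, until every cycle of `E` becomes a boundary
and every `E.X n` maps on through a directed colimit of modules from `S n`; the colimit of the
resulting sequence lies in the class. To stay countably presentable, each step may attach only
countably many pieces, so the cycle modules must be countably generated. This is where coherence
enters: it makes kernels of maps between countably presentable modules countably generated. The
condition on terms is met by `exists_factor_of_isCountablyRelated`.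

Countable presentability of complexes is termwise (`isCardinalPresentable_X`,
`isCountablyPresentable_of_X`), and the `ℵ₁`-presentable objects of the class are retracts of the
members just constructed; this identifies them. -/

open Limits Opposite

namespace AcyclicLim

/-! ### Countably generated kernels and countable coherence. -/

section Algebra

variable {A : Type u} [Ring A] {M N F : Type u} [AddCommGroup M] [Module A M]
  [AddCommGroup N] [Module A N] [AddCommGroup F] [Module A F]

/-- A submodule is countably generated if it is spanned by a countable set. -/
def IsCountablyGenerated (G : Submodule A M) : Prop :=
  ∃ s : Set M, s.Countable ∧ Submodule.span A s = G

namespace IsCountablyGenerated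

lemma of_fg {G : Submodule A M} (h : G.FG) : IsCountablyGenerated G := by
  obtain ⟨s, hs⟩ := h
  exact ⟨s, s.countable_toSet, hs⟩

lemma map {G : Submodule A M} (hG : IsCountablyGenerated G) (f : M →ₗ[A] N) :
    IsCountablyGenerated (G.map f) := by
  obtain ⟨s, hs, rfl⟩ := hG
  exact ⟨f '' s, hs.image f, (Submodule.map_span f s).symm⟩

lemma iSup {ι : Type*} [Countable ι] {G : ι → Submodule A M}
    (hG : ∀ i, IsCountablyGenerated (G i)) : IsCountablyGenerated (⨆ i, G i) := by
  choose s hs h using hG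
  exact ⟨⋃ i, s i, Set.countable_iUnion hs, by rw [Submodule.span_iUnion]; simp only [h]⟩

lemma sup {G H : Submodule A M} (hG : IsCountablyGenerated G) (hH : IsCountablyGenerated H) :
    IsCountablyGenerated (G ⊔ H) := by
  obtain ⟨s, hs, rfl⟩ := hG
  obtain ⟨t, ht, rfl⟩ := hH
  exact ⟨s ∪ t, hs.union ht, Submodule.span_union s t⟩

/-- A countably generated submodule is the union of a monotone sequence of finitely
generated submodules. -/
lemma exists_monotone_fg {G : Submodule A M} (hG : IsCountablyGenerated G) :
    ∃ H : ℕ → Submodule A M, Monotone H ∧ (∀ n, (H n).FG) ∧ ⨆ n, H n = G := by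
  obtain ⟨s, hs, rfl⟩ := hG
  obtain ⟨t, ht, hfin, rfl⟩ : ∃ t : ℕ → Set M, Monotone t ∧ (∀ n, (t n).Finite) ∧
      ⋃ n, t n = s := by
    rcases s.eq_empty_or_nonempty with rfl | hne
    · exact ⟨fun _ => ∅, monotone_const, fun _ => Set.finite_empty, by simp⟩
    · obtain ⟨f, rfl⟩ := hs.exists_eq_range hne
      refine ⟨fun n => f '' Set.Iic n, fun a b h => Set.image_mono (Set.Iic_subset_Iic.2 h),
        fun n => (Set.finite_Iic n).image f, ?_⟩
      rw [← Set.image_iUnion, Set.iUnion_Iic, Set.image_univ]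
  exact ⟨fun n => Submodule.span A (t n), fun a b h => Submodule.span_mono (ht h),
    fun n => Submodule.fg_span (hfin n), (Submodule.span_iUnion t).symm⟩

end IsCountablyGenerated

variable (A M) in
/-- A module is countably related if it is a quotient of a free module with a countable basis
by a countably generated submodule. -/
def IsCountablyRelated : Prop :=
  ∃ (ι : Type u) (_ : Countable ι) (p : (ι →₀ A) →ₗ[A] M),
    Function.Surjective p ∧ IsCountablyGenerated (LinearMap.ker p)

lemma IsCountablyRelated.of_equiv (h : IsCountablyRelated A M) (e : M ≃ₗ[A] N) :
    IsCountablyRelated A N := by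
  obtain ⟨ι, _, p, hp, hk⟩ := h
  refine ⟨ι, inferInstance, e.toLinearMap ∘ₗ p, e.surjective.comp hp, ?_⟩
  rwa [LinearEquiv.ker_comp]

lemma IsCountablyRelated.isCountablyGenerated_top (h : IsCountablyRelated A M) :
    IsCountablyGenerated (⊤ : Submodule A M) := by
  obtain ⟨ι, _, p, hp, -⟩ := h
  refine ⟨Set.range fun i => p (Finsupp.single i 1), Set.countable_range _, ?_⟩
  have : Set.range (fun i => p (Finsupp.single i 1)) =
      p '' Set.range (fun i => Finsupp.single i (1 : A)) := by
    rw [← Set.range_comp]; rfl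
  rw [this, ← Submodule.map_span]
  have h2 := (Finsupp.basisSingleOne (R := A) (ι := ι)).span_eq
  simp only [Finsupp.coe_basisSingleOne] at h2
  rw [h2, Submodule.map_top, LinearMap.range_eq_top.2 hp]

/-- Kernels of maps from countably generated modules onto countably related modules are
countably generated. -/
lemma IsCountablyRelated.isCountablyGenerated_ker (h : IsCountablyRelated A M)
    (hF : IsCountablyGenerated (⊤ : Submodule A F)) (g : F →ₗ[A] M)
    (hg : Function.Surjective g) : IsCountablyGenerated (LinearMap.ker g) := by
  obtain ⟨ι, _, p, hp, hk⟩ := h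
  obtain ⟨s, hs, hspan⟩ := hF
  choose q₀ hq₀ using fun i : ι => hg (p (Finsupp.single i 1))
  let q : (ι →₀ A) →ₗ[A] F := Finsupp.linearCombination A q₀
  have hq : g ∘ₗ q = p := by
    ext i
    simp [q, hq₀]
  have hq' (x) : g (q x) = p x := LinearMap.congr_fun hq x
  choose t ht using fun x : F => hp (g x)
  -- Schanuel-type comparison: lift the free cover to `q`. The kernel of `g` is generated by the
  -- image of the old relations and the errors made when generators of `F` are rewritten through
  -- `q`.
  have key : LinearMap.ker g =
      (LinearMap.ker p).map q ⊔ Submodule.span A ((fun x => x - q (t x)) '' s) := by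
    apply le_antisymm
    · intro x hx
      have main : ∀ y ∈ Submodule.span A s, ∃ v, g y = p v ∧
          y - q v ∈ Submodule.span A ((fun x => x - q (t x)) '' s) := by
        intro y hy
        induction hy using Submodule.span_induction with
        | mem y hy => exact ⟨t y, (ht y).symm, Submodule.subset_span ⟨y, hy, rfl⟩⟩
        | zero => exact ⟨0, by simp, by simp⟩
        | add y z _ _ hy hz =>
          obtain ⟨v, hv, hv'⟩ := hy
          obtain ⟨w, hw, hw'⟩ := hz
          refine ⟨v + w, by simp [hv, hw], ?_⟩
          have := add_mem hv' hw'
          rw [map_add]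
          convert this using 1
          abel
        | smul a y _ hy =>
          obtain ⟨v, hv, hv'⟩ := hy
          refine ⟨a • v, by simp [hv], ?_⟩
          rw [map_smul, ← smul_sub]
          exact Submodule.smul_mem _ _ hv'
      obtain ⟨v, hv, hv'⟩ := main x (hspan ▸ Submodule.mem_top)
      rw [LinearMap.mem_ker] at hx
      have hv0 : v ∈ LinearMap.ker p := by rw [LinearMap.mem_ker, ← hv, hx]
      have := Submodule.add_mem_sup (Submodule.mem_map_of_mem (f := q) hv0) hv'
      rwa [add_sub_cancel] at this
    · refine sup_le ?_ ?_
      · rintro _ ⟨v, hv, rfl⟩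
        rw [LinearMap.mem_ker, hq']
        exact hv
      · rw [Submodule.span_le]
        rintro _ ⟨x, -, rfl⟩
        simp [hq', ht]
  rw [key]
  exact (hk.map q).sup ⟨_, hs.image _, rfl⟩

variable (A N) in
/-- A module `N` is countably coherent if, for every linear map to `N`, the kernel of its
restriction to a countably generated submodule is countably generated. -/
def IsCountablyCoherent : Prop :=
  ∀ (F : Type u) [AddCommGroup F] [Module A F] (h : F →ₗ[A] N) (G : Submodule A F),
    IsCountablyGenerated G → IsCountablyGenerated (G ⊓ LinearMap.ker h)

namespace IsCountablyCoherent

/-- A countably generated submodule is a directed union of finitely generated ones, and intersection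
distributes over directed unions. -/
lemma of_fg (H : ∀ (F : Type u) [AddCommGroup F] [Module A F] (h : F →ₗ[A] N)
    (G : Submodule A F), G.FG → IsCountablyGenerated (G ⊓ LinearMap.ker h)) :
    IsCountablyCoherent A N := by
  intro F _ _ h G hG
  obtain ⟨K, hK, hfg, rfl⟩ := hG.exists_monotone_fg
  rw [(hK.directed_le).iSup_inf_eq]
  exact .iSup fun n => H F h _ (hfg n)

/-- The image of a finitely generated `G` is a finitely generated ideal, hence countably related, so
the kernel of `G` onto it is countably generated. -/
lemma of_isCountablyRelated_ideal
    (H : ∀ I : Submodule A A, I.FG → IsCountablyRelated A I) : IsCountablyCoherent A A := by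
  refine of_fg fun F _ _ h G hG => ?_
  let g : G →ₗ[A] G.map h := h.submoduleMap G
  have hk := (H _ (hG.map h)).isCountablyGenerated_ker
    (.of_fg (Submodule.fg_top G |>.2 hG)) g (h.submoduleMap_surjective G)
  convert hk.map G.subtype
  ext x
  simp only [Submodule.mem_inf, LinearMap.mem_ker, Submodule.mem_map, Submodule.coe_subtype,
    Subtype.exists, exists_and_right, exists_eq_right, g]
  exact ⟨fun ⟨h1, h2⟩ => ⟨h1, Subtype.ext h2⟩, fun ⟨h1, h2⟩ => ⟨h1, congrArg Subtype.val h2⟩⟩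

/-- On a finitely generated `G` only finitely many coordinates of `h` are nonzero; their kernels are
intersected one at a time, each intersection being countably generated again. -/
lemma finsupp (hA : IsCountablyCoherent A A) (ι : Type u) : IsCountablyCoherent A (ι →₀ A) := by
  classical
  refine of_fg fun F _ _ h G hG => ?_
  have aux (s : Finset ι) :
      IsCountablyGenerated (G ⊓ ⨅ i ∈ s, LinearMap.ker (Finsupp.lapply i ∘ₗ h)) := by
    induction s using Finset.induction_on with
    | empty => simpa using .of_fg hG
    | insert i s _ hs =>
      rw [Finset.iInf_insert, inf_comm (LinearMap.ker _), ← inf_assoc]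
      exact hA _ _ _ hs
  obtain ⟨t, ht⟩ := hG
  convert aux (t.biUnion fun x => (h x).support) using 1
  apply le_antisymm
  · refine inf_le_inf_left _ ?_
    simp only [le_iInf_iff]
    intro i _ x hx
    rw [LinearMap.mem_ker] at hx ⊢
    simp [hx]
  · rintro x ⟨hxG, hx⟩
    refine ⟨hxG, ?_⟩
    have hsupp : ∀ y ∈ G, ((h y).support : Set ι) ⊆ (t.biUnion fun x => (h x).support) := by
      intro y hy
      have : G ≤ (Finsupp.supported A A
          ((t.biUnion fun x => (h x).support : Finset ι) : Set ι)).comap h := by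
        rw [← ht, Submodule.span_le]
        intro z hz
        simp only [Submodule.comap_coe, Set.mem_preimage, SetLike.mem_coe,
          Finsupp.mem_supported]
        intro i hi
        simp only [Finset.coe_biUnion, Set.mem_iUnion]
        exact ⟨z, hz, hi⟩
      exact this hy
    change h x = 0
    ext i
    by_cases hi : i ∈ t.biUnion fun x => (h x).support
    · simp only [Submodule.coe_iInf, Set.mem_iInter] at hx
      exact hx i hi
    · by_contra hne
      exact hi (by simpa using hsupp x hxG (Finsupp.mem_support_iff.2 hne))

lemma of_isCountablyRelated (hA : IsCountablyCoherent A A) (hN : IsCountablyRelated A N) :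
    IsCountablyCoherent A N := by
  intro F _ _ h G hG
  obtain ⟨ι, _, p, hp, hk⟩ := hN
  obtain ⟨s, hs, rfl⟩ := hG
  choose t ht using fun x : F => hp (h x)
  -- `G'` is the pullback of `h` on `span A s` and `p`. Its elements with zero second coordinate
  -- project onto the kernel sought, which reduces the claim to maps into a free module.
  let G' : Submodule A (F × (ι →₀ A)) :=
    Submodule.span A ((fun x => (x, t x)) '' s) ⊔ (LinearMap.ker p).map (LinearMap.inr A F _)
  have hG' : IsCountablyGenerated G' := IsCountablyGenerated.sup ⟨_, hs.image _, rfl⟩ (hk.map _)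
  have hmem (y) (hy : y ∈ G') : y.1 ∈ Submodule.span A s ∧ h y.1 = p y.2 := by
    have : G' ≤ (Submodule.span A s).comap (LinearMap.fst A F _) ⊓
        LinearMap.ker (h ∘ₗ LinearMap.fst A F (ι →₀ A) - p ∘ₗ LinearMap.snd A F (ι →₀ A)) := by
      refine sup_le ?_ ?_
      · rw [Submodule.span_le]
        rintro _ ⟨x, hx, rfl⟩
        exact ⟨Submodule.subset_span hx, by simp [ht]⟩
      · rintro _ ⟨v, hv, rfl⟩
        refine ⟨by simp, ?_⟩
        simpa using hv
    obtain ⟨h1, h2⟩ := this hy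
    refine ⟨h1, ?_⟩
    simpa [sub_eq_zero] using h2
  have main : ∀ y ∈ Submodule.span A s,
      ∃ v, (y, v) ∈ Submodule.span A ((fun x => (x, t x)) '' s) := by
    intro y hy
    have h1 : (Submodule.span A ((fun x => (x, t x)) '' s)).map (LinearMap.fst A F (ι →₀ A)) =
        Submodule.span A s := by
      rw [Submodule.map_span, ← Set.image_comp]
      congr 1
      exact Set.image_id s
    rw [← h1] at hy
    obtain ⟨⟨a, b⟩, hab, rfl⟩ := hy
    exact ⟨b, hab⟩
  convert (((hA.finsupp ι) _ (LinearMap.snd A F (ι →₀ A)) G' hG').map (LinearMap.fst A F _)) using 1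
  apply le_antisymm
  · rintro x ⟨hx, hx'⟩
    obtain ⟨v, hv⟩ := main x hx
    have hv' : (x, v) ∈ G' := Submodule.mem_sup_left hv
    have hpv : p v = 0 := by rw [← (hmem _ hv').2]; exact hx'
    refine ⟨(x, 0), ⟨?_, rfl⟩, rfl⟩
    have : ((0 : F), v) ∈ G' := Submodule.mem_sup_right ⟨v, hpv, rfl⟩
    simpa using sub_mem hv' this
  · rintro _ ⟨⟨x, w⟩, ⟨hx, hw⟩, rfl⟩
    obtain ⟨h1, h2⟩ := hmem _ hx
    refine ⟨h1, ?_⟩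
    have hw : w = 0 := hw
    subst hw
    simpa using h2

lemma isCountablyGenerated_ker (hN : IsCountablyCoherent A N)
    (hM : IsCountablyRelated A M) (f : M →ₗ[A] N) :
    IsCountablyGenerated (LinearMap.ker f) := by
  simpa using hN M f ⊤ hM.isCountablyGenerated_top

end IsCountablyCoherent

end Algebra

/-! ### Countably presentable modules have countable presentations. -/

section Modules

attribute [local instance] Cardinal.fact_isRegular_aleph0

variable (A : Type u) [Ring A]

/-- The property of modules of being countably related. -/
def isCountablyRelated : ObjectProperty (ModuleCat.{u} A) := fun M => IsCountablyRelated A M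

instance : (isCountablyRelated A).IsClosedUnderIsomorphisms where
  of_iso e h := IsCountablyRelated.of_equiv h e.toLinearEquiv

/-- Elements of a module as morphisms from the free module of rank one. -/
def homOfElement {M : ModuleCat.{u} A} (x : M) : ModuleCat.of.{u} A A ⟶ M :=
  ModuleCat.ofHom (LinearMap.toSpanSingleton A M x)

variable {A}

/-- The element of a module corresponding to a morphism from the free module of rank one. -/
def evalOne {M : ModuleCat.{u} A} (f : ModuleCat.of.{u} A A ⟶ M) : M := f.hom (1 : A)

@[simp]
lemma evalOne_homOfElement {M : ModuleCat.{u} A} (x : M) : evalOne (homOfElement A x) = x := by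
  simp [homOfElement, evalOne]

lemma evalOne_comp {M N : ModuleCat.{u} A} (f : ModuleCat.of.{u} A A ⟶ M) (g : M ⟶ N) :
    evalOne (f ≫ g) = g.hom (evalOne f) := rfl

lemma evalOne_injective {M : ModuleCat.{u} A} :
    Function.Injective (evalOne : (ModuleCat.of.{u} A A ⟶ M) → M) := by
  intro f g h
  ext
  exact h

section

variable {J : Type u} [SmallCategory J] {D : J ⥤ ModuleCat.{u} A} {c : Cocone D}

lemma exists_rep_of_isColimit [IsFiltered J] (hc : IsColimit c) (x : c.pt) :
    ∃ (j : J) (y : D.obj j), (c.ι.app j).hom y = x :=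
  Types.jointly_surjective_of_isColimit (isColimitOfPreserves (forget (ModuleCat.{u} A)) hc) x

lemma exists_map_eq_of_isColimit [IsFiltered J] (hc : IsColimit c) {i j : J} (x : D.obj i)
    (y : D.obj j) (h : (c.ι.app i).hom x = (c.ι.app j).hom y) :
    ∃ (k : J) (f : i ⟶ k) (g : j ⟶ k), (D.map f).hom x = (D.map g).hom y :=
  (Types.FilteredColimit.isColimit_eq_iff _
    (isColimitOfPreserves (forget (ModuleCat.{u} A)) hc)).1 h

end

instance isFinitelyPresentable_self :
    IsFinitelyPresentable.{u} (ModuleCat.of.{u} A A) where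
  preservesColimitOfShape J _ hJ := by
    rw [isCardinalFiltered_aleph0_iff] at hJ
    refine ⟨fun {D} => ⟨fun {c} hc => ⟨?_⟩⟩⟩
    refine Types.FilteredColimit.isColimitOf' _ _ (fun f => ?_) (fun j f g h => ?_)
    · obtain ⟨j, y, hy⟩ := exists_rep_of_isColimit hc (evalOne f)
      refine ⟨j, homOfElement A y, evalOne_injective ?_⟩
      exact ((evalOne_comp _ _).trans (by rw [evalOne_homOfElement, hy])).symm
    · obtain ⟨k, a, b, hab⟩ := exists_map_eq_of_isColimit hc (evalOne f) (evalOne g)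
        (congrArg evalOne h)
      obtain ⟨l, e, he⟩ : ∃ (l : J) (e : k ⟶ l), a ≫ e = b ≫ e :=
        ⟨_, _, IsFiltered.coeq_condition a b⟩
      refine ⟨l, a ≫ e, evalOne_injective ?_⟩
      change (D.map (a ≫ e)).hom (evalOne f) = (D.map (a ≫ e)).hom (evalOne g)
      conv_rhs => rw [he]
      simp only [Functor.map_comp, ModuleCat.hom_comp, LinearMap.comp_apply]
      rw [hab]

lemma isCardinalPresentable_self (κ : Cardinal.{u}) [hκ : Fact κ.IsRegular] :
    IsCardinalPresentable (ModuleCat.of.{u} A A) κ :=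
  isCardinalPresentable_of_le _ hκ.out.aleph0_le

lemma isStrongGenerator_self :
    (ObjectProperty.singleton (ModuleCat.of.{u} A A)).IsStrongGenerator := by
  rw [ObjectProperty.isStrongGenerator_iff]
  constructor
  · intro X Y f g h
    ext x
    have := congrArg evalOne (h _ (ObjectProperty.singleton_iff _ _ |>.2 rfl) (homOfElement A x))
    simpa only [evalOne_comp, evalOne_homOfElement] using this
  · intro X Y i _ h
    rw [ConcreteCategory.isIso_iff_bijective]
    refine ⟨(ModuleCat.mono_iff_injective i).1 inferInstance, fun y => ?_⟩
    obtain ⟨f, hf⟩ := h _ (ObjectProperty.singleton_iff _ _ |>.2 rfl) (homOfElement A y)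
    have := congrArg evalOne hf
    exact ⟨evalOne f, by simpa only [evalOne_comp, evalOne_homOfElement] using this⟩

instance isCardinalLocallyPresentable_moduleCat (κ : Cardinal.{u}) [hκ : Fact κ.IsRegular] :
    IsCardinalLocallyPresentable (ModuleCat.{u} A) κ := by
  rw [IsCardinalLocallyPresentable.iff_exists_isStrongGenerator]
  refine ⟨.singleton (ModuleCat.of.{u} A A), inferInstance, isStrongGenerator_self, ?_⟩
  simp only [ObjectProperty.singleton_le_iff, isCardinalPresentable_iff]
  exact isCardinalPresentable_self κ

lemma isCountablyRelated_self : IsCountablyRelated A A := by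
  refine ⟨PUnit, inferInstance, (Finsupp.uniqueLinearEquiv A A PUnit.unit).toLinearMap,
    LinearEquiv.surjective _, ?_⟩
  rw [LinearEquiv.ker]
  exact ⟨∅, Set.countable_empty, Submodule.span_empty⟩

/-- Countable colimits of countably related modules are countably related. -/
lemma isClosedUnderColimitsOfShape_isCountablyRelated (J : Type u) [SmallCategory J]
    [Countable J] [Countable (Arrow J)] :
    (isCountablyRelated A).IsClosedUnderColimitsOfShape J where
  colimitsOfShape_le X := by
    rintro ⟨h⟩
    choose ι hι p hp hk using h.prop_diag_obj
    let q : ((Σ j, ι j) →₀ A) →ₗ[A] X := Finsupp.linearCombination A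
      fun x => (h.ι.app x.1).hom (p x.1 (Finsupp.single x.2 1))
    let e (j : J) : (ι j →₀ A) →ₗ[A] ((Σ j, ι j) →₀ A) := Finsupp.lmapDomain A A (Sigma.mk j)
    have he (j : J) : q ∘ₗ e j = (h.ι.app j).hom ∘ₗ p j := by
      ext i
      simp [q, e]
    have he' (j : J) (x) : q (e j x) = (h.ι.app j).hom (p j x) := LinearMap.congr_fun (he j) x
    choose t ht using fun (f : Arrow J) (i : ι f.left) =>
      hp f.right ((h.diag.map f.hom).hom (p f.left (Finsupp.single i 1)))
    -- Expected relations of the colimit: those of each object, and for each arrow the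
    -- identification of a generator with a chosen lift of its image.
    let K : Submodule A ((Σ j, ι j) →₀ A) :=
      (⨆ j, (LinearMap.ker (p j)).map (e j)) ⊔
        Submodule.span A (Set.range fun (x : Σ (f : Arrow J), ι f.left) =>
          e x.1.left (Finsupp.single x.2 1) - e x.1.right (t x.1 x.2))
    have hK : K ≤ LinearMap.ker q := by
      refine sup_le (iSup_le fun j => ?_) ?_
      · rintro _ ⟨x, hx, rfl⟩
        rw [LinearMap.mem_ker, he', LinearMap.mem_ker.1 hx, map_zero]
      · rw [Submodule.span_le]
        rintro _ ⟨⟨f, i⟩, rfl⟩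
        have := congrArg (fun (g : h.diag.obj f.left ⟶ X) => g.hom (p f.left (Finsupp.single i 1)))
          (h.w f.hom)
        simp only [ModuleCat.hom_comp, LinearMap.comp_apply] at this
        simp only [SetLike.mem_coe, LinearMap.mem_ker, map_sub, he', ht, this, sub_self]
    have hKp (j : J) : LinearMap.ker (p j) ≤ LinearMap.ker (K.mkQ ∘ₗ e j) := fun x hx => by
      rw [LinearMap.mem_ker, LinearMap.comp_apply, Submodule.mkQ_apply,
        Submodule.Quotient.mk_eq_zero]
      exact Submodule.mem_sup_left (Submodule.mem_iSup_of_mem j ⟨x, hx, rfl⟩)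
    let s (j : J) : h.diag.obj j →ₗ[A] (((Σ j, ι j) →₀ A) ⧸ K) :=
      (LinearMap.ker (p j)).liftQ (K.mkQ ∘ₗ e j) (hKp j) ∘ₗ
        ((p j).quotKerEquivOfSurjective (hp j)).symm.toLinearMap
    have hs (j : J) (x) : s j (p j x) = K.mkQ (e j x) := by
      have : ((p j).quotKerEquivOfSurjective (hp j)).symm (p j x) =
          (LinearMap.ker (p j)).mkQ x := by
        rw [LinearEquiv.symm_apply_eq]
        rfl
      simp only [s, LinearMap.comp_apply, LinearEquiv.coe_coe, this]
      simp
    have hs' (f : Arrow J) : s f.right ∘ₗ (h.diag.map f.hom).hom = s f.left := by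
      rw [← LinearMap.cancel_right (hp f.left)]
      ext i
      simp only [LinearMap.comp_apply, Finsupp.lsingle_apply]
      rw [← ht, hs, hs, eq_comm, ← sub_eq_zero, ← map_sub, Submodule.mkQ_apply,
        Submodule.Quotient.mk_eq_zero]
      exact Submodule.mem_sup_right (Submodule.subset_span ⟨⟨f, i⟩, rfl⟩)
    -- By the universal property `X` maps back to the quotient by `K`; this gives `ker q ≤ K`.
    let σ : X ⟶ ModuleCat.of A (((Σ j, ι j) →₀ A) ⧸ K) := h.isColimit.desc
      { pt := _
        ι :=
          { app j := ModuleCat.ofHom (s j)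
            naturality j k f := by
              ext1
              simpa using hs' (Arrow.mk f) } }
    have hσ (j : J) (x) : σ.hom ((h.ι.app j).hom x) = s j x := by
      have := h.isColimit.fac { pt := ModuleCat.of A (((Σ j, ι j) →₀ A) ⧸ K)
                                ι :=
          { app j := ModuleCat.ofHom (s j)
            naturality j k f := by
              ext1
              simpa using hs' (Arrow.mk f) } } j
      exact congrArg (fun (g : h.diag.obj j ⟶ _) => g.hom x) this
    have hσq : σ.hom ∘ₗ q = K.mkQ := by
      ext ⟨j, i⟩
      have := hσ j (p j (Finsupp.single i 1))
      rw [hs, ← he'] at this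
      simpa [e] using this
    refine ⟨Σ j, ι j, inferInstance, q, ?_, ?_⟩
    · rw [← LinearMap.range_eq_top]
      have : ModuleCat.ofHom (LinearMap.range q).mkQ =
          (0 : X ⟶ ModuleCat.of A (X ⧸ LinearMap.range q)) := by
        refine h.isColimit.hom_ext fun j => ?_
        ext x
        obtain ⟨y, rfl⟩ := hp j x
        rw [comp_zero]
        change (LinearMap.range q).mkQ ((h.ι.app j).hom (p j y)) = 0
        rw [Submodule.mkQ_apply, Submodule.Quotient.mk_eq_zero]
        exact ⟨e j y, he' j y⟩
      rw [← Submodule.ker_mkQ (LinearMap.range q), LinearMap.ker_eq_top]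
      exact congrArg ModuleCat.Hom.hom this
    · have : LinearMap.ker q = K := by
        refine le_antisymm (fun x hx => ?_) hK
        have := LinearMap.congr_fun hσq x
        rw [LinearMap.comp_apply, LinearMap.mem_ker.1 hx, map_zero, eq_comm, Submodule.mkQ_apply,
          Submodule.Quotient.mk_eq_zero] at this
        exact this
      rw [this]
      exact (IsCountablyGenerated.iSup fun j => (hk j).map _).sup ⟨_, Set.countable_range _, rfl⟩

lemma countable_of_hasCardinalLT {X : Type u} (h : HasCardinalLT X (Cardinal.aleph.{u} 1)) :
    Countable X := by
  rw [hasCardinalLT_iff_cardinal_mk_lt] at h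
  rw [← Cardinal.mk_le_aleph0_iff, ← Order.lt_succ_iff]
  rwa [Cardinal.succ_aleph0]

lemma hasCardinalLT_of_countable {X : Type v} [Countable X] :
    HasCardinalLT X (Cardinal.aleph.{u} 1) := by
  rw [HasCardinalLT, Cardinal.lift_aleph, Ordinal.lift_one, ← Cardinal.succ_aleph0,
    Order.lt_succ_iff]
  simp

/-- Countably presentable modules are the closure of the strong generator `A` under countable
colimits, and countably related modules contain `A` and are closed under these. -/
lemma isCountablyRelated_of_isCountablyPresentable (M : ModuleCat.{u} A)
    (hM : IsCountablyPresentable.{u} M) : IsCountablyRelated A M := by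
  have h1 : isCardinalPresentable (ModuleCat.{u} A) (Cardinal.aleph.{u} 1) M := hM
  rw [IsStrongGenerator.colimitsCardinalClosure_eq_isCardinalPresentable
    (κ := Cardinal.aleph.{u} 1) isStrongGenerator_self (by
      simp only [ObjectProperty.singleton_le_iff, isCardinalPresentable_iff]
      exact isCardinalPresentable_self _)] at h1
  refine ObjectProperty.colimitsCardinalClosure_le (Q := isCountablyRelated A) _ _
    (fun J _ hJ => ?_) ?_ _ h1
  · have := countable_of_hasCardinalLT hJ
    have : Countable J := Function.Injective.countable (f := fun j : J => Arrow.mk (𝟙 j))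
      (fun _ _ h => congrArg Arrow.leftFunc.obj h)
    exact isClosedUnderColimitsOfShape_isCountablyRelated J
  · simp only [ObjectProperty.singleton_le_iff]
    exact isCountablyRelated_self

end Modules

/-! ### Factoring through countable directed colimits. -/

section Factor

attribute [local instance] Cardinal.fact_isRegular_aleph0

lemma IsDirectedPoset.isCardinalFiltered {κ : Cardinal.{u}} [Fact κ.IsRegular] {J : Type u}
    [PartialOrder J] (hJ : IsDirectedPoset κ J) : IsCardinalFiltered J κ :=
  isCardinalFiltered_preorder _ _ fun K s hK => by
    obtain ⟨j, hj⟩ := hJ (Set.range s) (Cardinal.mk_range_le.trans_lt hK)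
    exact ⟨j, fun k => hj ⟨k, rfl⟩⟩

lemma isDirectedPoset_of_isCardinalFiltered {κ : Cardinal.{u}} [Fact κ.IsRegular] {J : Type u}
    [PartialOrder J] [IsCardinalFiltered J κ] : IsDirectedPoset κ J := fun s hs =>
  ⟨IsCardinalFiltered.max (Subtype.val : s → J) (by rwa [hasCardinalLT_iff_cardinal_mk_lt]),
    fun x hx => leOfHom (IsCardinalFiltered.toMax (Subtype.val : s → J)
      (by rwa [hasCardinalLT_iff_cardinal_mk_lt]) ⟨x, hx⟩)⟩

instance countable_arrow {J : Type u} [Category.{v} J] [Countable J]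
    [∀ i j : J, Countable (i ⟶ j)] : Countable (Arrow J) :=
  Function.Surjective.countable (f := fun x : Σ (i j : J), (i ⟶ j) => Arrow.mk x.2.2)
    fun f => ⟨⟨_, _, f.hom⟩, rfl⟩

/-- Every `κ`-filtered category receives a final functor from a `κ`-directed poset, so filtered
categories may replace posets throughout. -/
lemma directedColimits_iff {κ : Cardinal.{w}} [Fact κ.IsRegular] {C : Type u} [Category.{v} C]
    {P : ObjectProperty C} {X : C} :
    directedColimits κ P X ↔ ∃ (J : Type w) (_ : SmallCategory J) (_ : IsCardinalFiltered J κ),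
      P.colimitsOfShape J X := by
  constructor
  · rintro ⟨J, _, hJ, hX⟩
    exact ⟨J, inferInstance, hJ.isCardinalFiltered, hX⟩
  · rintro ⟨J, _, _, hX⟩
    obtain ⟨α, _, _, F, _⟩ := IsCardinalFiltered.exists_cardinal_directed J κ
    exact ⟨α, inferInstance, isDirectedPoset_of_isCardinalFiltered,
      P.colimitsOfShape_le_of_final F _ hX⟩

/-- In a directed poset, a sequence is dominated by a monotone sequence. -/
lemma exists_monotone_seq_ge {J : Type u} [PartialOrder J] [IsDirectedOrder J] (t : ℕ → J) :
    ∃ g : ℕ → J, Monotone g ∧ ∀ n, t n ≤ g n := by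
  choose ub h1 h2 using fun a b : J => exists_ge_ge a b
  let g : ℕ → J := fun n => Nat.rec (t 0) (fun n x => ub x (t (n + 1))) n
  refine ⟨g, monotone_nat_of_le_succ fun n => h1 _ _, fun n => ?_⟩
  cases n with
  | zero => exact le_rfl
  | succ n => exact h2 _ _

variable {A : Type u} [Ring A]

/-- A morphism from a countably related module to a directed colimit of finitely presentable
modules from `P` factors through a countably presentable directed colimit of modules from `P`. -/
lemma exists_factor_of_isCountablyRelated {P : ObjectProperty (ModuleCat.{u} A)}
    (hP : ∀ M, P M → IsFinitelyPresentable.{u} M) {E M : ModuleCat.{u} A}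
    (hE : IsCountablyRelated A E) (hM : directedColimits Cardinal.aleph0.{u} P M) (f : E ⟶ M) :
    ∃ (L : ModuleCat.{u} A) (a : E ⟶ L) (b : L ⟶ M), IsCountablyPresentable.{u} L ∧
      directedColimits Cardinal.aleph0.{u} P L ∧ a ≫ b = f := by
  classical
  obtain ⟨J, _, hJ, ⟨h⟩⟩ := hM
  have := hJ.isCardinalFiltered
  have : IsFiltered J := isFiltered_of_isCardinalFiltered J Cardinal.aleph0.{u}
  have : IsDirectedOrder J := IsFiltered.isDirectedOrder _
  obtain ⟨ι, _, p, hp, s, hs, hspan⟩ := hE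
  choose a x hx using fun i : ι =>
    exists_rep_of_isColimit h.isColimit (f.hom (p (Finsupp.single i 1)))
  have hmap {j k l : J} (u : j ≤ k) (v : k ≤ l) (y : h.diag.obj j) :
      (h.diag.map (homOfLE v)).hom ((h.diag.map (homOfLE u)).hom y) =
        (h.diag.map (homOfLE (u.trans v))).hom y := by
    rw [← LinearMap.comp_apply, ← ModuleCat.hom_comp, ← Functor.map_comp]
    rfl
  have hι {j k : J} (u : j ≤ k) (y : h.diag.obj j) :
      (h.ι.app k).hom ((h.diag.map (homOfLE u)).hom y) = (h.ι.app j).hom y := by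
    rw [← LinearMap.comp_apply, ← ModuleCat.hom_comp, h.w]
  let φ (j : J) : (ι →₀ A) →ₗ[A] h.diag.obj j := Finsupp.linearCombination A
    fun i => if hi : a i ≤ j then (h.diag.map (homOfLE hi)).hom (x i) else 0
  have hφ (j : J) (r : ι →₀ A) (hr : ∀ i ∈ r.support, a i ≤ j) :
      (h.ι.app j).hom (φ j r) = f.hom (p r) := by
    conv_rhs => rw [← Finsupp.sum_single r]
    simp only [φ, Finsupp.linearCombination_apply, Finsupp.sum, map_sum, map_smul]
    refine Finset.sum_congr rfl fun i hi => ?_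
    rw [dif_pos (hr i hi), hι]
    have : Finsupp.single i (r i) = r i • Finsupp.single i (1 : A) := by simp
    rw [this, map_smul, map_smul, ← hx i]
  have hφ' {j k : J} (u : j ≤ k) (r : ι →₀ A) (hr : ∀ i ∈ r.support, a i ≤ j) :
      (h.diag.map (homOfLE u)).hom (φ j r) = φ k r := by
    simp only [φ, Finsupp.linearCombination_apply, Finsupp.sum, map_sum, map_smul]
    refine Finset.sum_congr rfl fun i hi => ?_
    rw [dif_pos (hr i hi), dif_pos ((hr i hi).trans u), hmap]
  have hJne : Nonempty J := IsFiltered.nonempty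
  have hrel (r : s) : ∃ k : J, (∀ i ∈ (r : ι →₀ A).support, a i ≤ k) ∧ φ k r = 0 := by
    obtain ⟨j, hj⟩ := ((r : ι →₀ A).support.image a).exists_le
    replace hj : ∀ i ∈ (r : ι →₀ A).support, a i ≤ j := fun i hi =>
      hj _ (Finset.mem_image_of_mem a hi)
    have hr : p r = 0 := by
      have : (r : ι →₀ A) ∈ LinearMap.ker p := hspan ▸ Submodule.subset_span r.2
      exact this
    obtain ⟨k, u, v, huv⟩ := exists_map_eq_of_isColimit h.isColimit (φ j r) (0 : h.diag.obj j)
      (by rw [map_zero]; exact (hφ j r hj).trans (by rw [hr, map_zero]))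
    refine ⟨k, fun i hi => (hj i hi).trans (leOfHom u), ?_⟩
    rw [← hφ' (leOfHom u) r hj]
    rw [map_zero] at huv
    exact huv
  choose b hb hb' using hrel
  have := hs.to_subtype
  -- Countably many stages matter: `a i`, where the image of a generator is represented, and `b r`,
  -- where a relation already holds. A monotone sequence dominating them carries the whole
  -- presentation.
  obtain ⟨t, ht⟩ : ∃ t : ℕ → J, ∀ z : ι ⊕ s, ∃ n, t n = Sum.elim a b z := by
    rcases isEmpty_or_nonempty (ι ⊕ s) with hemp | hne
    · exact ⟨fun _ => hJne.some, fun z => hemp.elim z⟩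
    · obtain ⟨e, he⟩ := exists_surjective_nat (ι ⊕ s)
      exact ⟨Sum.elim a b ∘ e, fun z => (he z).imp fun n hn => by rw [Function.comp, hn]⟩
  obtain ⟨g, hg, hgt⟩ := exists_monotone_seq_ge t
  have hga (i : ι) : ∃ n, a i ≤ g n := by
    obtain ⟨n, hn⟩ := ht (.inl i)
    exact ⟨n, hn.symm.le.trans (hgt n)⟩
  have hgb (r : s) : ∃ n, b r ≤ g n := by
    obtain ⟨n, hn⟩ := ht (.inr r)
    exact ⟨n, hn.symm.le.trans (hgt n)⟩
  choose n hn using hga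
  choose m hm using hgb
  let G : ULift.{u} ℕ ⥤ J := Monotone.functor (f := fun n => g n.down) fun _ _ h => hg h
  let D := G ⋙ h.diag
  let γ (k : ℕ) : h.diag.obj (g k) →ₗ[A] (colimit D : ModuleCat.{u} A) := (colimit.ι D ⟨k⟩).hom
  have hι' {k l : ℕ} (u : k ≤ l) (y : h.diag.obj (g k)) :
      γ l ((h.diag.map (homOfLE (hg u))).hom y) = γ k y := by
    dsimp only [γ]
    rw [← colimit.w D (homOfLE (show (⟨k⟩ : ULift.{u} ℕ) ≤ ⟨l⟩ from u))]
    rfl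
  let ψ : (ι →₀ A) →ₗ[A] (colimit D : ModuleCat.{u} A) := Finsupp.linearCombination A
    fun i => γ (n i) ((h.diag.map (homOfLE (hn i))).hom (x i))
  have hψ (k : ℕ) (r : ι →₀ A) (hr : ∀ i ∈ r.support, a i ≤ g k) :
      ψ r = γ k (φ (g k) r) := by
    simp only [ψ, φ, Finsupp.linearCombination_apply, Finsupp.sum]
    rw [map_sum]
    refine Finset.sum_congr rfl fun i hi => ?_
    rw [map_smul, dif_pos (hr i hi)]
    congr 1
    rcases le_total (n i) k with hk | hk
    · rw [← hι' hk, hmap]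
    · rw [← hι' hk, hmap]
  have hψker : LinearMap.ker p ≤ LinearMap.ker ψ := by
    rw [← hspan, Submodule.span_le]
    intro r hr
    have h1 := hm ⟨r, hr⟩
    have h2 := hb ⟨r, hr⟩
    rw [SetLike.mem_coe, LinearMap.mem_ker, hψ (m ⟨r, hr⟩) r fun i hi => (h2 i hi).trans h1,
      ← hφ' h1 r h2, hb' ⟨r, hr⟩, map_zero, map_zero]
  let α : E →ₗ[A] (colimit D : ModuleCat.{u} A) :=
    (LinearMap.ker p).liftQ ψ hψker ∘ₗ (p.quotKerEquivOfSurjective hp).symm.toLinearMap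
  have hα (r : ι →₀ A) : α (p r) = ψ r := by
    have : (p.quotKerEquivOfSurjective hp).symm (p r) = (LinearMap.ker p).mkQ r := by
      rw [LinearEquiv.symm_apply_eq]
      rfl
    simp only [α, LinearMap.comp_apply, LinearEquiv.coe_coe, this]
    simp
  have hL : P.ColimitOfShape (ULift.{u} ℕ) (colimit D) :=
    ObjectProperty.ColimitOfShape.colimit D fun j => h.prop_diag_obj _
  let σ : Cocone D :=
    { pt := M
      ι := { app k := h.ι.app (g k.down)
             naturality k l u := by
              exact (h.w (G.map u)).trans (Category.comp_id _).symm } }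
  have hσ (k : ℕ) (y : h.diag.obj (g k)) :
      (colimit.desc D σ).hom (γ k y) = (h.ι.app (g k)).hom y :=
    congrArg (fun q : h.diag.obj (g k) ⟶ M => q.hom y) (colimit.ι_desc σ ⟨k⟩)
  refine ⟨colimit D, ModuleCat.ofHom α, colimit.desc D σ, ?_, ?_, ?_⟩
  · exact hL.isCardinalPresentable (fun M hM => hP M hM) _ (Cardinal.aleph0_le_aleph 1)
      hasCardinalLT_of_countable
  · exact ⟨ULift.{u} ℕ, inferInstance, fun s hs => by
      have : s.Finite := Cardinal.lt_aleph0_iff_set_finite.1 hs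
      exact this.bddAbove, ⟨hL⟩⟩
  · ext y
    obtain ⟨r, rfl⟩ := hp y
    change (colimit.desc D σ).hom (α (p r)) = _
    rw [hα]
    induction r using Finsupp.induction_linear with
    | zero => simp
    | add r r' h1 h2 => rw [map_add, map_add, h1, h2, map_add, map_add]
    | single i c =>
      have : Finsupp.single i c = c • Finsupp.single i (1 : A) := by simp
      rw [this, map_smul, map_smul, map_smul, map_smul]
      congr 1
      simp only [ψ, Finsupp.linearCombination_single, one_smul]
      exact (hσ _ _).trans ((hι (hn i) (x i)).trans (hx i))

end Factor

/-! ### Cofinality and canonical filtered colimits. -/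

section FilteredGenerator

variable {C : Type u} [Category.{v} C] {κ : Cardinal.{w}} [Fact κ.IsRegular]

/-- If `F : C ⥤ D` is fully faithful, `D` is `κ`-filtered and every object of `D` maps to an
object in the image of `F`, then `C` is `κ`-filtered. -/
lemma isCardinalFiltered_of_exists_of_fullyFaithful {C₁ : Type*} [Category* C₁] {C₂ : Type*}
    [Category* C₂] (F : C₁ ⥤ C₂) [F.Full] [F.Faithful] [IsCardinalFiltered C₂ κ]
    (h : ∀ d, ∃ c, Nonempty (d ⟶ F.obj c)) : IsCardinalFiltered C₁ κ where
  nonempty_cocone {K _} G hK := by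
    let c := IsCardinalFiltered.cocone (G ⋙ F) hK
    obtain ⟨d, ⟨f⟩⟩ := h c.pt
    exact ⟨{ pt := d
             ι := { app k := F.preimage (c.ι.app k ≫ f)
                    naturality k l g := F.map_injective (by
                      simpa using congrArg (· ≫ f) (c.w g)) } }⟩

/-- In a `κ`-accessible category, an object `X` is a `κ`-filtered colimit of `κ`-presentable
objects from `P` if every morphism to `X` from a `κ`-presentable object factors through an
object from `P`. -/
lemma exists_colimitsOfShape_of_factor [IsCardinalAccessibleCategory C κ] {P : ObjectProperty C}
    (H : P ≤ isCardinalPresentable C κ) {X : C}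
    (hfac : ∀ {Z : C} (g : Z ⟶ X), IsCardinalPresentable Z κ →
      ∃ (W : C) (u : Z ⟶ W) (v : W ⟶ X), u ≫ v = g ∧ P W) :
    ∃ (J : Type w) (_ : SmallCategory J) (_ : IsCardinalFiltered J κ), P.colimitsOfShape J X := by
  let incl : P.FullSubcategory ⥤ (isCardinalPresentable C κ).FullSubcategory :=
    ObjectProperty.ιOfLE H
  -- The factorization says that each object of the canonical diagram maps to one coming from `P`.
  -- For a full subcategory of a `κ`-filtered category this gives both finality and
  -- `κ`-filteredness.
  have H (d : CostructuredArrow (isCardinalPresentable C κ).ι X) : ∃ c,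
      Nonempty (d ⟶ (CostructuredArrow.pre incl (isCardinalPresentable C κ).ι X).obj c) := by
    obtain ⟨W, u, v, huv, hW⟩ := hfac d.hom d.left.2
    exact ⟨CostructuredArrow.mk (Y := ObjectProperty.FullSubcategory.mk _ hW) v,
      ⟨CostructuredArrow.homMk ⟨u⟩ huv⟩⟩
  have : IsFiltered (CostructuredArrow (isCardinalPresentable C κ).ι X) :=
    isFiltered_of_isCardinalFiltered _ κ
  have : (CostructuredArrow.pre incl (isCardinalPresentable C κ).ι X).Final :=
    Functor.final_of_exists_of_isFiltered_of_fullyFaithful (C := CostructuredArrow (incl ⋙ _) X)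
      (CostructuredArrow.pre incl (isCardinalPresentable C κ).ι X) H
  have : IsCardinalFiltered (CostructuredArrow P.ι X) κ :=
    isCardinalFiltered_of_exists_of_fullyFaithful (C₁ := CostructuredArrow (incl ⋙ _) X)
      (CostructuredArrow.pre incl (isCardinalPresentable C κ).ι X) H
  obtain ⟨hc⟩ : P.ι.isDenseAt X :=
    Functor.IsDenseAt.of_final (F := (isCardinalPresentable C κ).ι) incl
      (Functor.IsDense.isDenseAt _ _)
  have : EssentiallySmall.{w} (CostructuredArrow P.ι X) :=
    essentiallySmall_of_fully_faithful (C := CostructuredArrow (incl ⋙ _) X)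
      (CostructuredArrow.pre incl (isCardinalPresentable C κ).ι X)
  let e := equivSmallModel.{w} (CostructuredArrow P.ι X)
  let p : P.ColimitOfShape (CostructuredArrow P.ι X) X :=
    { toColimitPresentation := ⟨_, _, hc⟩, prop_diag_obj Y := Y.left.2 }
  exact ⟨_, inferInstance, IsCardinalFiltered.of_equivalence κ e, ⟨p.reindex e.inverse⟩⟩

end FilteredGenerator

/-! ### Presentability of complexes is termwise. -/

section Complexes

variable {A : Type u} [Ring A]

/-- The contractible complex `X = X` concentrated in degrees `n` and `n + 1`. -/
noncomputable abbrev disc (n : ℤ) (X : ModuleCat.{u} A) : CochainComplex (ModuleCat.{u} A) ℤ :=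
  HomologicalComplex.double (𝟙 X) (show (ComplexShape.up ℤ).Rel n (n + 1) from rfl)

/-- Evaluation in degree `n` is corepresented by `disc n X`. -/
noncomputable def discCorepresentableBy (n : ℤ) (X : ModuleCat.{u} A) :
    (HomologicalComplex.eval (ModuleCat.{u} A) (ComplexShape.up ℤ) n ⋙
      coyoneda.obj (op X)).CorepresentableBy (disc n X) :=
  HomologicalComplex.evalCompCoyonedaCorepresentableByDoubleId _ (by simp) X

/-- Morphisms from `disc n X` to `K` are morphisms from `X` to `K.X n`. -/
noncomputable def discEquiv (n : ℤ) (X : ModuleCat.{u} A)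
    (K : CochainComplex (ModuleCat.{u} A) ℤ) : (disc n X ⟶ K) ≃ (X ⟶ K.X n) :=
  (discCorepresentableBy n X).homEquiv

lemma discEquiv_comp (n : ℤ) (X : ModuleCat.{u} A) {K L : CochainComplex (ModuleCat.{u} A) ℤ}
    (f : disc n X ⟶ K) (g : K ⟶ L) : discEquiv n X L (f ≫ g) = discEquiv n X K f ≫ g.f n :=
  (discCorepresentableBy n X).homEquiv_comp g f

lemma discEquiv_symm_comp (n : ℤ) (X : ModuleCat.{u} A)
    {K L : CochainComplex (ModuleCat.{u} A) ℤ} (f : X ⟶ K.X n) (g : K ⟶ L) :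
    (discEquiv n X K).symm f ≫ g = (discEquiv n X L).symm (f ≫ g.f n) := by
  rw [← Equiv.apply_eq_iff_eq (discEquiv n X L), discEquiv_comp]
  simp

instance isCardinalPresentable_disc (κ : Cardinal.{u}) [Fact κ.IsRegular] (n : ℤ)
    (X : ModuleCat.{u} A) [IsCardinalPresentable X κ] : IsCardinalPresentable (disc n X) κ := by
  have : (HomologicalComplex.eval (ModuleCat.{u} A) (ComplexShape.up ℤ) n).IsCardinalAccessible κ :=
    { }
  exact Functor.isCardinalAccessible_of_natIso (discCorepresentableBy n X).toIso.symm κ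

lemma isStrongGenerator_disc :
    (ObjectProperty.ofObj fun n : ℤ => disc n (ModuleCat.of.{u} A A)).IsStrongGenerator := by
  rw [ObjectProperty.isStrongGenerator_iff]
  have hP (n : ℤ) : (ObjectProperty.ofObj fun n : ℤ => disc n (ModuleCat.of.{u} A A))
    (disc n (ModuleCat.of.{u} A A)) := ⟨n⟩
  constructor
  · intro X Y f g h
    ext n x
    have := congrArg (fun q => evalOne (discEquiv _ _ _ q))
      (h _ (hP n) ((discEquiv _ _ _).symm (homOfElement A x)))
    simpa only [discEquiv_symm_comp, Equiv.apply_symm_apply, evalOne_comp,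
      evalOne_homOfElement] using this
  · intro X Y i _ h
    have (n : ℤ) : IsIso (i.f n) := by
      rw [ConcreteCategory.isIso_iff_bijective]
      refine ⟨(ModuleCat.mono_iff_injective (i.f n)).1 inferInstance, fun y => ?_⟩
      obtain ⟨f, hf⟩ := h _ (hP n) ((discEquiv _ _ _).symm (homOfElement A y))
      have := congrArg (fun q => evalOne (discEquiv _ _ _ q)) hf
      exact ⟨evalOne (discEquiv _ _ _ f), by
        simpa only [discEquiv_comp, Equiv.apply_symm_apply, evalOne_comp,
          evalOne_homOfElement] using this⟩
    exact HomologicalComplex.Hom.isIso_of_components i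

lemma ofObj_disc_le (κ : Cardinal.{u}) [Fact κ.IsRegular] :
    (ObjectProperty.ofObj fun n : ℤ => disc n (ModuleCat.of.{u} A A)) ≤
      isCardinalPresentable (CochainComplex (ModuleCat.{u} A) ℤ) κ := by
  rintro _ ⟨n⟩
  have := isCardinalPresentable_self (A := A) κ
  rw [isCardinalPresentable_iff]
  infer_instance

instance isCardinalLocallyPresentable_cochainComplex (κ : Cardinal.{u}) [Fact κ.IsRegular] :
    IsCardinalLocallyPresentable (CochainComplex (ModuleCat.{u} A) ℤ) κ := by
  have : HasColimitsOfSize.{u, u} (CochainComplex (ModuleCat.{u} A) ℤ) := ⟨inferInstance⟩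
  rw [IsCardinalLocallyPresentable.iff_exists_isStrongGenerator]
  exact ⟨_, inferInstance, isStrongGenerator_disc, ofObj_disc_le κ⟩

lemma isCardinalPresentable_X_disc (κ : Cardinal.{u}) [Fact κ.IsRegular] (n k : ℤ)
    (X : ModuleCat.{u} A) [IsCardinalPresentable X κ] :
    IsCardinalPresentable ((disc n X).X k) κ := by
  by_cases h₀ : k = n
  · subst h₀
    exact isCardinalPresentable_of_iso (HomologicalComplex.doubleXIso₀ _ _).symm κ
  · by_cases h₁ : k = n + 1
    · subst h₁
      exact isCardinalPresentable_of_iso (HomologicalComplex.doubleXIso₁ _ _ (by simp)).symm κ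
    · have h : Retract ((disc n X).X k) X :=
        { i := 0
          r := 0
          retract := (HomologicalComplex.isZero_double_X _ _ k h₀ h₁).eq_of_src _ _ }
      exact h.isCardinalPresentable κ

/-- Presentable complexes are generated under `κ`-small colimits by discs on `A`, whose terms are
`A` or `0`; evaluation in a degree preserves colimits. -/
lemma isCardinalPresentable_X {κ : Cardinal.{u}} [Fact κ.IsRegular]
    (K : CochainComplex (ModuleCat.{u} A) ℤ) (hK : IsCardinalPresentable K κ) (n : ℤ) :
    IsCardinalPresentable (K.X n) κ := by
  have h1 : isCardinalPresentable (CochainComplex (ModuleCat.{u} A) ℤ) κ K := hK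
  have : HasColimitsOfSize.{u, u} (CochainComplex (ModuleCat.{u} A) ℤ) := ⟨inferInstance⟩
  rw [IsStrongGenerator.colimitsCardinalClosure_eq_isCardinalPresentable
    isStrongGenerator_disc (ofObj_disc_le κ)] at h1
  refine ObjectProperty.colimitsCardinalClosure_le
    (Q := (isCardinalPresentable (ModuleCat.{u} A) κ).inverseImage
      (HomologicalComplex.eval (ModuleCat.{u} A) (ComplexShape.up ℤ) n)) _ _
    (fun J _ hJ => ?_) ?_ _ h1
  · have := isClosedUnderColimitsOfShape_isCardinalPresentable (ModuleCat.{u} A) hJ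
    infer_instance
  · rintro _ ⟨m⟩
    have := isCardinalPresentable_self (A := A) κ
    exact isCardinalPresentable_X_disc κ m n _

section

variable {κ : Cardinal.{u}} [Fact κ.IsRegular] {J : Type u} [SmallCategory J]
  [IsCardinalFiltered J κ] {D : J ⥤ CochainComplex (ModuleCat.{u} A) ℤ} {c : Cocone D}
  {M : ModuleCat.{u} A} {n : ℤ}

lemma cocone_w_f {J : Type*} [Category* J] {D : J ⥤ CochainComplex (ModuleCat.{u} A) ℤ}
    (c : Cocone D) {j k : J} (a : j ⟶ k) (n : ℤ) :
    (D.map a).f n ≫ (c.ι.app k).f n = (c.ι.app j).f n := by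
  rw [← HomologicalComplex.comp_f, c.w]

lemma exists_hom_of_isColimit_X (hc : IsColimit c) (hM : IsCardinalPresentable M κ)
    (f : M ⟶ c.pt.X n) : ∃ (j : J) (g : M ⟶ (D.obj j).X n), g ≫ (c.ι.app j).f n = f :=
  IsCardinalPresentable.exists_hom_of_isColimit κ (isColimitOfPreserves
    (HomologicalComplex.eval (ModuleCat.{u} A) (ComplexShape.up ℤ) n) hc) f

lemma exists_eq_of_isColimit_X (hc : IsColimit c) (hM : IsCardinalPresentable M κ) {j : J}
    (f g : M ⟶ (D.obj j).X n) (h : f ≫ (c.ι.app j).f n = g ≫ (c.ι.app j).f n) :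
    ∃ (k : J) (a : j ⟶ k), f ≫ (D.map a).f n = g ≫ (D.map a).f n :=
  IsCardinalPresentable.exists_eq_of_isColimit' κ (isColimitOfPreserves
    (HomologicalComplex.eval (ModuleCat.{u} A) (ComplexShape.up ℤ) n) hc) f g h

end

/-- A morphism of complexes consists of countably many components subject to countably many
equations, and `ℵ₁`-filteredness supplies one stage where all are realized. -/
lemma isCountablyPresentable_of_X (K : CochainComplex (ModuleCat.{u} A) ℤ)
    (hK : ∀ n, IsCountablyPresentable.{u} (K.X n)) : IsCountablyPresentable.{u} K where
  preservesColimitOfShape J _ _ := ⟨fun {D} => ⟨fun {c} hc => ⟨by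
    have := isFiltered_of_isCardinalFiltered J (Cardinal.aleph.{u} 1)
    have hℤ : HasCardinalLT ℤ (Cardinal.aleph.{u} 1) := hasCardinalLT_of_countable
    have hℤ' : HasCardinalLT (ℤ × ℤ) (Cardinal.aleph.{u} 1) := hasCardinalLT_of_countable
    refine Types.FilteredColimit.isColimitOf' _ _ (fun (f : K ⟶ c.pt) => ?_)
      (fun j (f g : K ⟶ D.obj j) h => ?_)
    · choose j g hg using fun n => exists_hom_of_isColimit_X hc (hK n) (f.f n)
      let m := IsCardinalFiltered.max j hℤ
      obtain ⟨g', hg'⟩ : ∃ g' : ∀ n, K.X n ⟶ (D.obj m).X n,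
          ∀ n, g' n ≫ (c.ι.app m).f n = f.f n :=
        ⟨fun n => g n ≫ (D.map (IsCardinalFiltered.toMax j hℤ n)).f n, fun n => by
          rw [Category.assoc, cocone_w_f, hg]⟩
      -- The lifted components need not commute with the differentials at stage `m`; each such
      -- equation holds after mapping to the colimit, hence at some later stage.
      choose k a ha using fun n : ℤ × ℤ => exists_eq_of_isColimit_X hc (hK n.1)
        (g' n.1 ≫ (D.obj m).d n.1 n.2) (K.d n.1 n.2 ≫ g' n.2) (by
          rw [Category.assoc, Category.assoc, hg', ← HomologicalComplex.Hom.comm,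
            ← HomologicalComplex.Hom.comm, reassoc_of% hg']
          rfl)
      obtain ⟨l, b, e, hb⟩ := IsCardinalFiltered.wideSpan a hℤ'
      refine ⟨l, { f n := g' n ≫ (D.map e).f n, comm' i j _ := ?_ }, ?_⟩
      · have := congrArg (· ≫ (D.map (b (i, j))).f j) (ha (i, j))
        simp only [Category.assoc, ← HomologicalComplex.comp_f, ← D.map_comp, hb] at this
        rw [← this]
        simp
      · apply HomologicalComplex.hom_ext
        intro n
        change f.f n = (g' n ≫ (D.map e).f n) ≫ (c.ι.app l).f n
        rw [Category.assoc, cocone_w_f, hg']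
    · choose k a ha using fun n => exists_eq_of_isColimit_X hc (hK n) (f.f n) (g.f n)
        (congrArg (fun q : K ⟶ c.pt => q.f n) h)
      obtain ⟨l, b, e, hb⟩ := IsCardinalFiltered.wideSpan a hℤ
      refine ⟨l, e, ?_⟩
      apply HomologicalComplex.hom_ext
      intro n
      have := congrArg (· ≫ (D.map (b n)).f n) (ha n)
      simp only [Category.assoc, ← HomologicalComplex.comp_f, ← D.map_comp, hb] at this
      exact this⟩⟩⟩

end Complexes

/-! ### Stability of the class under filtered colimits. -/

section Closure

attribute [local instance] Cardinal.fact_isRegular_aleph0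

variable {A : Type u} [Ring A]

/-- Turns membership into a factorization property of maps from finitely presentable modules, which
can be checked stage by stage in a filtered colimit. -/
lemma directedColimits_aleph0_iff {P : ObjectProperty (ModuleCat.{u} A)}
    (hP : ∀ M, P M → IsFinitelyPresentable.{u} M) {M : ModuleCat.{u} A} :
    directedColimits Cardinal.aleph0.{u} P M ↔ ∀ (Z : ModuleCat.{u} A) (g : Z ⟶ M),
      IsFinitelyPresentable.{u} Z → ∃ (W : ModuleCat.{u} A) (a : Z ⟶ W) (b : W ⟶ M),
        a ≫ b = g ∧ P W := by
  rw [directedColimits_iff]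
  constructor
  · rintro ⟨J, _, _, ⟨h⟩⟩ Z g hZ
    obtain ⟨j, a, ha⟩ := IsCardinalPresentable.exists_hom_of_isColimit
      Cardinal.aleph0.{u} h.isColimit g
    exact ⟨_, a, _, ha, h.prop_diag_obj j⟩
  · intro h
    exact exists_colimitsOfShape_of_factor (fun M hM => hP M hM) fun g hZ => h _ g hZ

lemma acyclic_iff (K : CochainComplex (ModuleCat.{u} A) ℤ) :
    K.Acyclic ↔ ∀ (i : ℤ) (x : K.X (i + 1)), (K.d (i + 1) (i + 1 + 1)).hom x = 0 →
      ∃ y : K.X i, (K.d i (i + 1)).hom y = x := by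
  have (i : ℤ) : K.ExactAt (i + 1) ↔ ∀ x : K.X (i + 1),
      (K.d (i + 1) (i + 1 + 1)).hom x = 0 → ∃ y : K.X i, (K.d i (i + 1)).hom y = x := by
    rw [K.exactAt_iff' i (i + 1) (i + 1 + 1) (by simp) (by simp),
      ShortComplex.moduleCat_exact_iff]
    rfl
  constructor
  · intro h i
    exact (this i).1 (h (i + 1))
  · intro h i
    obtain ⟨j, rfl⟩ : ∃ j, i = j + 1 := ⟨i - 1, by simp⟩
    exact (this j).2 (h j)

section

variable {J : Type u} [SmallCategory J] [IsFiltered J]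
  {D : J ⥤ CochainComplex (ModuleCat.{u} A) ℤ} {c : Cocone D}

/-- The stages need not be acyclic: a cycle only has to become a boundary further along, which is
what the inductive construction provides. -/
lemma acyclic_of_isColimit (hc : IsColimit c)
    (H : ∀ (j : J) (i : ℤ), ∃ (k : J) (a : j ⟶ k), ∀ x : (D.obj j).X (i + 1),
      ((D.obj j).d (i + 1) (i + 1 + 1)).hom x = 0 →
        ∃ y : (D.obj k).X i, ((D.obj k).d i (i + 1)).hom y = ((D.map a).f (i + 1)).hom x) :
    c.pt.Acyclic := by
  rw [acyclic_iff]
  intro i x hx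
  have hc' (n : ℤ) := isColimitOfPreserves
      (HomologicalComplex.eval (ModuleCat.{u} A) (ComplexShape.up ℤ) n) hc
  have hd {K L : CochainComplex (ModuleCat.{u} A) ℤ} (f : K ⟶ L) (i j : ℤ) (x : K.X i) :
      (L.d i j).hom ((f.f i).hom x) = (f.f j).hom ((K.d i j).hom x) := by
    simp only [← LinearMap.comp_apply, ← ModuleCat.hom_comp, f.comm]
  have hw {j k : J} (a : j ⟶ k) (n : ℤ) (x : (D.obj j).X n) :
      ((c.ι.app k).f n).hom (((D.map a).f n).hom x) = ((c.ι.app j).f n).hom x := by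
    rw [← LinearMap.comp_apply, ← ModuleCat.hom_comp, cocone_w_f]
  obtain ⟨j, x, rfl⟩ : ∃ (j : J) (x' : (D.obj j).X (i + 1)), ((c.ι.app j).f (i + 1)).hom x' = x :=
    exists_rep_of_isColimit (hc' (i + 1)) x
  rw [hd] at hx
  obtain ⟨k, a, b, hab⟩ : ∃ (k : J) (a : j ⟶ k) (b : j ⟶ k), ((D.map a).f (i + 1 + 1)).hom
      (((D.obj j).d (i + 1) (i + 1 + 1)).hom x) = ((D.map b).f (i + 1 + 1)).hom 0 :=
    exists_map_eq_of_isColimit (hc' (i + 1 + 1)) (((D.obj j).d (i + 1) (i + 1 + 1)).hom x)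
      (0 : (D.obj j).X (i + 1 + 1)) (hx.trans (map_zero ((c.ι.app j).f (i + 1 + 1)).hom).symm)
  rw [map_zero, ← hd] at hab
  obtain ⟨l, e, he⟩ := H k i
  obtain ⟨y, hy⟩ := he _ hab
  refine ⟨((c.ι.app l).f i).hom y, ?_⟩
  rw [hd, hy, hw, hw]

/-- Here too the stages may lie outside the class; it suffices that transition maps pass through it,
since a finitely presentable source already maps to some stage. -/
lemma directedColimits_X_of_isColimit (hc : IsColimit c) (n : ℤ)
    {P : ObjectProperty (ModuleCat.{u} A)} (hP : ∀ M, P M → IsFinitelyPresentable.{u} M)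
    (H : ∀ j : J, ∃ (k : J) (a : j ⟶ k) (L : ModuleCat.{u} A) (f : (D.obj j).X n ⟶ L)
      (g : L ⟶ (D.obj k).X n), directedColimits Cardinal.aleph0.{u} P L ∧
        f ≫ g = (D.map a).f n) :
    directedColimits Cardinal.aleph0.{u} P (c.pt.X n) := by
  have := (isCardinalFiltered_aleph0_iff.{u} J).2 inferInstance
  rw [directedColimits_aleph0_iff hP]
  intro Z g hZ
  obtain ⟨j, g, rfl⟩ := exists_hom_of_isColimit_X hc hZ g
  obtain ⟨k, a, L, p, q, hL, hpq⟩ := H j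
  obtain ⟨W, s, t, hst, hW⟩ := (directedColimits_aleph0_iff hP).1 hL Z (g ≫ p) hZ
  refine ⟨W, s, t ≫ q ≫ (c.ι.app k).f n, ?_, hW⟩
  rw [reassoc_of% hst, reassoc_of% hpq, cocone_w_f]

end

/-- The acyclic complexes whose terms are directed colimits of modules from `S n`. -/
def acyclicInLim (S : ℤ → ObjectProperty (ModuleCat.{u} A)) :
    ObjectProperty (CochainComplex (ModuleCat.{u} A) ℤ) :=
  fun K => K.Acyclic ∧ ∀ n : ℤ, directedColimits Cardinal.aleph0.{u} (S n) (K.X n)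

lemma isClosedUnderColimitsOfShape_acyclicInLim {S : ℤ → ObjectProperty (ModuleCat.{u} A)}
    (hS : ∀ n M, S n M → IsFinitelyPresentable.{u} M) (J : Type u) [SmallCategory J]
    [IsFiltered J] :
    (acyclicInLim S).IsClosedUnderColimitsOfShape J where
  colimitsOfShape_le X := by
    rintro ⟨h⟩
    refine ⟨acyclic_of_isColimit h.isColimit fun j i => ⟨j, 𝟙 j, fun x hx => ?_⟩, fun n =>
      directedColimits_X_of_isColimit h.isColimit n (hS n) fun j => ⟨j, 𝟙 j, _, 𝟙 _, 𝟙 _,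
        (h.prop_diag_obj j).2 n, by simp⟩⟩
    simpa using (acyclic_iff _).1 (h.prop_diag_obj j).1 i x hx

end Closure

/-! ### Elementary enlargements over a fixed complex. -/

section Steps

variable {A : Type u} [Ring A] {C : CochainComplex (ModuleCat.{u} A) ℤ}

/-- Pushouts of countably presentable complexes over a given complex. -/
lemma exists_pushout_over {E U V : CochainComplex (ModuleCat.{u} A) ℤ}
    (hE : IsCountablyPresentable.{u} E) (hU : IsCountablyPresentable.{u} U)
    (hV : IsCountablyPresentable.{u} V) (f : E ⟶ C) (a : U ⟶ E) (b : U ⟶ V) (g : V ⟶ C)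
    (h : a ≫ f = b ≫ g) :
    ∃ (E' : CochainComplex (ModuleCat.{u} A) ℤ) (_ : IsCountablyPresentable.{u} E')
      (u : E ⟶ E') (f' : E' ⟶ C) (v : V ⟶ E'), u ≫ f' = f ∧ a ≫ u = b ≫ v := by
  refine ⟨pushout a b, ?_, pushout.inl a b, pushout.desc f g h, pushout.inr a b,
    pushout.inl_desc _ _ _, pushout.condition⟩
  have (k : WalkingSpan) : IsCountablyPresentable.{u} ((span a b).obj k) := by
    rcases k with _ | _ | _ <;> assumption
  exact isCardinalPresentable_of_isColimit _ (colimit.isColimit (span a b)) _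
    hasCardinalLT_of_countable

/-- A cycle with values in an acyclic complex can be killed. -/
lemma exists_step_boundary (hC : C.Acyclic) {E : CochainComplex (ModuleCat.{u} A) ℤ}
    (hE : IsCountablyPresentable.{u} E) (f : E ⟶ C) (i : ℤ) (z : E.X (i + 1))
    (hz : (E.d (i + 1) (i + 1 + 1)).hom z = 0) :
    ∃ (E' : CochainComplex (ModuleCat.{u} A) ℤ) (_ : IsCountablyPresentable.{u} E')
      (u : E ⟶ E') (f' : E' ⟶ C), u ≫ f' = f ∧
        ∃ y : E'.X i, (E'.d i (i + 1)).hom y = (u.f (i + 1)).hom z := by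
  have := isCardinalPresentable_self (A := A) (Cardinal.aleph.{u} 1)
  obtain ⟨y, hy⟩ := (acyclic_iff C).1 hC i ((f.f (i + 1)).hom z) (by
    rw [← LinearMap.comp_apply, ← ModuleCat.hom_comp, f.comm, ModuleCat.hom_comp,
      LinearMap.comp_apply, hz, map_zero])
  let R := ModuleCat.of.{u} A A
  let gen : R ⟶ (disc i R).X i := discEquiv i R _ (𝟙 _)
  -- This pushout freely adjoins to `E` an element of degree `i` with differential `z`; sending it
  -- to `y` extends the map to `C`.
  obtain ⟨E', hE', u, f', v, huf, huv⟩ := exists_pushout_over (U := disc (i + 1) R)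
    (V := disc i R) hE inferInstance inferInstance f
    ((discEquiv (i + 1) R E).symm (homOfElement A z))
    ((discEquiv (i + 1) R _).symm (gen ≫ (disc i R).d i (i + 1)))
    ((discEquiv i R C).symm (homOfElement A y)) (by
      rw [discEquiv_symm_comp, discEquiv_symm_comp, Category.assoc,
        ← HomologicalComplex.Hom.comm, ← Category.assoc, ← discEquiv_comp, Category.id_comp,
        Equiv.apply_symm_apply]
      congr 1
      apply evalOne_injective
      simp only [evalOne_comp, evalOne_homOfElement, hy])
  refine ⟨E', hE', u, f', huf, evalOne (gen ≫ v.f i), ?_⟩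
  rw [discEquiv_symm_comp, discEquiv_symm_comp, Equiv.apply_eq_iff_eq, Category.assoc,
    ← HomologicalComplex.Hom.comm, ← Category.assoc] at huv
  rw [← evalOne_comp, ← huv, evalOne_comp, evalOne_homOfElement]

/-- A term of a countably presentable complex can be made to factor through a countably
presentable module of the given class. -/
lemma exists_step_factor {E : CochainComplex (ModuleCat.{u} A) ℤ}
    (hE : IsCountablyPresentable.{u} E) (f : E ⟶ C) (n : ℤ)
    {P : ObjectProperty (ModuleCat.{u} A)}
    (hP : ∀ M, P M → IsFinitelyPresentable.{u} M)
    (hC : directedColimits Cardinal.aleph0.{u} P (C.X n)) :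
    ∃ (E' : CochainComplex (ModuleCat.{u} A) ℤ) (_ : IsCountablyPresentable.{u} E')
      (u : E ⟶ E') (f' : E' ⟶ C), u ≫ f' = f ∧
        ∃ (L : ModuleCat.{u} A) (a : E.X n ⟶ L) (b : L ⟶ E'.X n),
          directedColimits Cardinal.aleph0.{u} P L ∧ a ≫ b = u.f n := by
  have hEn := isCardinalPresentable_X E hE n
  obtain ⟨L, a, b, hL, hL', hab⟩ := exists_factor_of_isCountablyRelated hP
    (isCountablyRelated_of_isCountablyPresentable _ hEn) hC (f.f n)
  -- Pushing out along `disc n (E.X n) ⟶ disc n L` forces `E.X n ⟶ E'.X n` to pass through `L`.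
  obtain ⟨E', hE', u, f', v, huf, huv⟩ := exists_pushout_over (U := disc n (E.X n))
    (V := disc n L) hE inferInstance inferInstance f
    ((discEquiv n _ E).symm (𝟙 _))
    ((discEquiv n _ _).symm (a ≫ discEquiv n L _ (𝟙 _)))
    ((discEquiv n L C).symm b) (by
      rw [discEquiv_symm_comp, discEquiv_symm_comp, Category.assoc, ← discEquiv_comp,
        Category.id_comp, Category.id_comp, Equiv.apply_symm_apply, hab])
  refine ⟨E', hE', u, f', huf, L, a, discEquiv n L _ (𝟙 _) ≫ v.f n, hL', ?_⟩
  rw [discEquiv_symm_comp, discEquiv_symm_comp, Equiv.apply_eq_iff_eq, Category.assoc,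
    Category.id_comp] at huv
  exact huv.symm

/-- Countably many enlargements of a countably presentable complex over `C` are dominated by a
single one. -/
lemma exists_step_of_countable {ι : Type*} [Countable ι]
    {E : CochainComplex (ModuleCat.{u} A) ℤ} (hE : IsCountablyPresentable.{u} E) (f : E ⟶ C)
    (W : ι → ∀ E' : CochainComplex (ModuleCat.{u} A) ℤ, (E ⟶ E') → Prop)
    (hW : ∀ i E' E'' (u : E ⟶ E') (v : E' ⟶ E''), W i E' u → W i E'' (u ≫ v))
    (H : ∀ i, ∃ (E' : CochainComplex (ModuleCat.{u} A) ℤ) (_ : IsCountablyPresentable.{u} E')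
      (u : E ⟶ E') (f' : E' ⟶ C), u ≫ f' = f ∧ W i E' u) :
    ∃ (E' : CochainComplex (ModuleCat.{u} A) ℤ) (_ : IsCountablyPresentable.{u} E')
      (u : E ⟶ E') (f' : E' ⟶ C), u ≫ f' = f ∧ ∀ i, W i E' u := by
  choose E' hE' u f' huf hu using H
  let T := CostructuredArrow (isCardinalPresentable (CochainComplex (ModuleCat.{u} A) ℤ)
    (Cardinal.aleph.{u} 1)).ι C
  let t₀ : T := CostructuredArrow.mk (Y := ObjectProperty.FullSubcategory.mk E hE) f
  let t (i : ι) : T :=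
    CostructuredArrow.mk (Y := ObjectProperty.FullSubcategory.mk (E' i) (hE' i)) (f' i)
  let φ (i : ι) : t₀ ⟶ t i := CostructuredArrow.homMk (ObjectProperty.homMk (u i)) (huf i)
  -- Countably presentable complexes over `C` form an `ℵ₁`-filtered category, so the enlargements
  -- are amalgamated under `E`.
  obtain ⟨m, a, b, hab⟩ := IsCardinalFiltered.wideSpan (κ := Cardinal.aleph.{u} 1) φ
    hasCardinalLT_of_countable
  refine ⟨m.left.obj, m.left.property, b.left.hom, m.hom, CostructuredArrow.w b, fun i => ?_⟩
  have : b.left.hom = u i ≫ (a i).left.hom := by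
    rw [← hab i]
    rfl
  rw [this]
  exact hW i _ _ _ _ (hu i)

end Steps

/-! ### The factorization theorem and accessibility. -/

section Main

variable {A : Type u} [Ring A] {C : CochainComplex (ModuleCat.{u} A) ℤ}

variable {S : ℤ → ObjectProperty (ModuleCat.{u} A)}

lemma exists_step (hA : IsCountablyCoherent A A)
    (hS : ∀ n M, S n M → IsFinitelyPresentable.{u} M) (hC : acyclicInLim S C)
    {E : CochainComplex (ModuleCat.{u} A) ℤ}
    (hE : IsCountablyPresentable.{u} E) (f : E ⟶ C) :
    ∃ (E' : CochainComplex (ModuleCat.{u} A) ℤ) (_ : IsCountablyPresentable.{u} E')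
      (u : E ⟶ E') (f' : E' ⟶ C), u ≫ f' = f ∧
        (∀ (i : ℤ) (z : E.X (i + 1)), (E.d (i + 1) (i + 1 + 1)).hom z = 0 →
          ∃ y : E'.X i, (E'.d i (i + 1)).hom y = (u.f (i + 1)).hom z) ∧
        ∀ n : ℤ, ∃ (L : ModuleCat.{u} A) (a : E.X n ⟶ L) (b : L ⟶ E'.X n),
          directedColimits Cardinal.aleph0.{u} (S n) L ∧ a ≫ b = u.f n := by
  have hE' (n : ℤ) : IsCountablyRelated A (E.X n) :=
    isCountablyRelated_of_isCountablyPresentable _ (isCardinalPresentable_X E hE n)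
  have hker (n : ℤ) : IsCountablyGenerated (LinearMap.ker (E.d n (n + 1)).hom) :=
    (hA.of_isCountablyRelated (hE' _)).isCountablyGenerated_ker (hE' _) _
  choose s hs hspan using fun n : ℤ => hker (n + 1)
  have (n : ℤ) : Countable (s n) := (hs n).to_subtype
  -- Countably many tasks: one for each chosen generator of a cycle module, one for the term in each
  -- degree.
  let W (i : (Σ n : ℤ, s n) ⊕ ℤ) (E' : CochainComplex (ModuleCat.{u} A) ℤ) (u : E ⟶ E') : Prop :=
    match i with
    | .inl z => ∃ y : E'.X z.1, (E'.d z.1 (z.1 + 1)).hom y = (u.f (z.1 + 1)).hom z.2.1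
    | .inr n => ∃ (L : ModuleCat.{u} A) (a : E.X n ⟶ L) (b : L ⟶ E'.X n),
        directedColimits Cardinal.aleph0.{u} (S n) L ∧ a ≫ b = u.f n
  obtain ⟨E', hE', u, f', huf, hu⟩ := exists_step_of_countable hE f W (by
    rintro (z | n) E' E'' u v
    · rintro ⟨y, hy⟩
      refine ⟨(v.f z.1).hom y, ?_⟩
      rw [HomologicalComplex.comp_f, ModuleCat.hom_comp, LinearMap.comp_apply, ← hy,
        ← LinearMap.comp_apply, ← LinearMap.comp_apply, ← ModuleCat.hom_comp,
        ← ModuleCat.hom_comp, v.comm]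
    · rintro ⟨L, a, b, hL, hab⟩
      exact ⟨L, a, b ≫ v.f n, hL, by rw [reassoc_of% hab, HomologicalComplex.comp_f]⟩) (by
    rintro (⟨n, z⟩ | n)
    · refine exists_step_boundary hC.1 hE f n z.1 ?_
      have : z.1 ∈ LinearMap.ker (E.d (n + 1) (n + 1 + 1)).hom :=
        hspan n ▸ Submodule.subset_span z.2
      exact this
    · exact exists_step_factor hE f n (hS n) (hC.2 n))
  refine ⟨E', hE', u, f', huf, fun i z hz => ?_, fun n => hu (.inr n)⟩
  -- Cycles that become boundaries form a submodule, so treating the generators suffices.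
  have hle : LinearMap.ker (E.d (i + 1) (i + 1 + 1)).hom ≤
      (LinearMap.range (E'.d i (i + 1)).hom).comap (u.f (i + 1)).hom := by
    rw [← hspan i, Submodule.span_le]
    intro z hz
    exact hu (.inl ⟨i, z, hz⟩)
  exact hle hz

/-- A morphism from a countably presentable complex to a complex `C` in the class factors
through a countably presentable complex in the class. -/
theorem exists_factor_acyclicInLim (hA : IsCountablyCoherent A A)
    (hS : ∀ n M, S n M → IsFinitelyPresentable.{u} M) (hC : acyclicInLim S C)
    {E : CochainComplex (ModuleCat.{u} A) ℤ}
    (hE : IsCountablyPresentable.{u} E) (f : E ⟶ C) :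
    ∃ (T : CochainComplex (ModuleCat.{u} A) ℤ) (a : E ⟶ T) (b : T ⟶ C), a ≫ b = f ∧
      acyclicInLim S T ∧ IsCountablyPresentable.{u} T := by
  let Q := Σ' (E : CochainComplex (ModuleCat.{u} A) ℤ) (_ : IsCountablyPresentable.{u} E), E ⟶ C
  choose E' hE' u f' huf hu hu' using fun q : Q => exists_step hA hS hC q.2.1 q.2.2
  let q (n : ℕ) : Q := Nat.rec ⟨E, hE, f⟩ (fun _ q => ⟨E' q, hE' q, f' q⟩) n
  let F : ℕ ⥤ CochainComplex (ModuleCat.{u} A) ℤ :=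
    Functor.ofSequence (X := fun n => (q n).1) fun n => u (q n)
  have hF (n : ℕ) : F.map (homOfLE (Nat.le_succ n)) = u (q n) :=
    Functor.ofSequence_map_homOfLE_succ _ n
  let σ : F ⟶ (Functor.const ℕ).obj C := NatTrans.ofSequence (fun n => (q n).2.2) fun n => by
    rw [hF]
    exact (huf (q n)).trans (Category.comp_id _).symm
  let G : ULift.{u} ℕ ⥤ ℕ := Monotone.functor (f := ULift.down) fun _ _ h => h
  let D := G ⋙ F
  have hD (n : ℕ) : D.map (homOfLE (show (⟨n⟩ : ULift.{u} ℕ) ≤ ⟨n + 1⟩ from Nat.le_succ n)) =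
    u (q n) := hF n
  let c : Cocone D := { pt := C, ι := Functor.whiskerLeft G σ }
  refine ⟨colimit D, colimit.ι D ⟨0⟩, colimit.desc D c, colimit.ι_desc _ _, ⟨?_, fun n => ?_⟩, ?_⟩
  · refine acyclic_of_isColimit (colimit.isColimit D) fun ⟨n⟩ i => ⟨⟨n + 1⟩, homOfLE
      (show (⟨n⟩ : ULift.{u} ℕ) ≤ ⟨n + 1⟩ from Nat.le_succ n), fun x hx => ?_⟩
    rw [hD]
    exact hu (q n) i x hx
  · refine directedColimits_X_of_isColimit (colimit.isColimit D) n (hS n) fun ⟨k⟩ => ⟨⟨k + 1⟩,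
      homOfLE (show (⟨k⟩ : ULift.{u} ℕ) ≤ ⟨k + 1⟩ from Nat.le_succ k), ?_⟩
    rw [hD]
    exact hu' (q k) n
  · have (k : ULift.{u} ℕ) : IsCountablyPresentable.{u} (D.obj k) := (q k.down).2.1
    exact isCardinalPresentable_of_isColimit _ (colimit.isColimit D) _ hasCardinalLT_of_countable

lemma exists_colimitsOfShape_acyclicInLim (hA : IsCountablyCoherent A A)
    (hS : ∀ n M, S n M → IsFinitelyPresentable.{u} M) (hC : acyclicInLim S C) :
    ∃ (J : Type u) (_ : SmallCategory J) (_ : IsCardinalFiltered J (Cardinal.aleph.{u} 1)),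
      ObjectProperty.colimitsOfShape
        (fun T => acyclicInLim S T ∧ IsCountablyPresentable.{u} T) J C :=
  exists_colimitsOfShape_of_factor (fun _ hT => hT.2) fun g hZ => by
    obtain ⟨T, a, b, hab, hT⟩ := exists_factor_acyclicInLim hA hS hC hZ g
    exact ⟨T, a, b, hab, hT⟩

section

variable {𝒞 : Type v} [Category.{w} 𝒞] {κ : Cardinal.{u}} [Fact κ.IsRegular]
  {P : ObjectProperty 𝒞}

/-- An object of a full subcategory closed under `κ`-filtered colimits is `κ`-presentable if it
is `κ`-presentable in the ambient category. -/
lemma isCardinalPresentable_fullSubcategory [HasCardinalFilteredColimits.{u} 𝒞 κ]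
    (hP : ∀ (J : Type u) [SmallCategory J] [IsCardinalFiltered J κ],
      P.IsClosedUnderColimitsOfShape J)
    (X : P.FullSubcategory) (hX : IsCardinalPresentable X.obj κ) : IsCardinalPresentable X κ where
  preservesColimitOfShape J _ _ := by
    have := hP J
    have := HasCardinalFilteredColimits.hasColimitsOfShape 𝒞 κ J
    have := preservesColimitsOfShape_of_isCardinalPresentable X.obj κ J
    let e : coyoneda.obj (op X) ≅ P.ι ⋙ coyoneda.obj (op X.obj) :=
      NatIso.ofComponents (fun Y => (P.fullyFaithfulι.homEquiv (X := X) (Y := Y)).toIso)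
    exact preservesColimitsOfShape_of_natIso e.symm

end

/-- The objects of a full subcategory which belong to an essentially small property of objects of
the ambient category form an essentially small property. -/
lemma essentiallySmall_inverseImage_ι {𝒞 : Type v} [Category.{w} 𝒞] (P Q : ObjectProperty 𝒞)
    [ObjectProperty.EssentiallySmall.{u} Q] :
    ObjectProperty.EssentiallySmall.{u} (Q.inverseImage P.ι) := by
  obtain ⟨Q', _, -, hQ'⟩ := ObjectProperty.EssentiallySmall.exists_small_le Q
  -- Full faithfulness of `P.ι` reflects isomorphisms between objects, so one preimage per
  -- representative is enough.
  let I := {q : Subtype Q' // ∃ X : P.FullSubcategory, Nonempty (X.obj ≅ q.1)}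
  have : Small.{u} I := inferInstance
  choose X hX using fun q : I => q.2
  have : ObjectProperty.EssentiallySmall.{u} (ObjectProperty.ofObj X).isoClosure := inferInstance
  refine .of_le (Q := (ObjectProperty.ofObj X).isoClosure) fun Y hY => ?_
  obtain ⟨q, hq, ⟨e⟩⟩ := hQ' _ hY
  let i : I := ⟨⟨q, hq⟩, Y, ⟨e⟩⟩
  exact ⟨X i, ⟨i⟩, ⟨P.fullyFaithfulι.preimageIso (e ≪≫ (hX i).some.symm)⟩⟩

/-- Over a countably coherent ring, the class `acyclicInLim S` is `ℵ₁`-accessible, its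
`ℵ₁`-presentable objects are the complexes with countably presentable terms, and every complex in
the class is an `ℵ₁`-directed colimit of these. -/
theorem acyclicInLim_accessible (hA : IsCountablyCoherent A A)
    (hS : ∀ n M, S n M → IsFinitelyPresentable.{u} M) :
    IsCardinalAccessibleCategory (acyclicInLim S).FullSubcategory (Cardinal.aleph.{u} 1) ∧
      (∀ T : (acyclicInLim S).FullSubcategory, IsCountablyPresentable.{u} T ↔
          ∀ n : ℤ, IsCountablyPresentable.{u} (T.obj.X n)) ∧
      (∀ C : CochainComplex (ModuleCat.{u} A) ℤ, acyclicInLim S C →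
        directedColimits (Cardinal.aleph.{u} 1)
          (fun T : CochainComplex (ModuleCat.{u} A) ℤ =>
            acyclicInLim S T ∧ ∀ n : ℤ, IsCountablyPresentable.{u} (T.X n)) C) := by
  have hclosed (J : Type u) [SmallCategory J] [IsCardinalFiltered J (Cardinal.aleph.{u} 1)] :
      (acyclicInLim S).IsClosedUnderColimitsOfShape J := by
    have := isFiltered_of_isCardinalFiltered J (Cardinal.aleph.{u} 1)
    exact isClosedUnderColimitsOfShape_acyclicInLim hS J
  have hcolim : HasColimitsOfSize.{u, u} (CochainComplex (ModuleCat.{u} A) ℤ) := ⟨inferInstance⟩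
  let P : ObjectProperty (acyclicInLim S).FullSubcategory :=
    fun T => IsCountablyPresentable.{u} T.obj
  have hPle : P ≤ isCardinalPresentable _ (Cardinal.aleph.{u} 1) := fun T hT =>
    isCardinalPresentable_fullSubcategory hclosed T hT
  have hgen : P.IsCardinalFilteredGenerator (Cardinal.aleph.{u} 1) :=
    { le_isCardinalPresentable := hPle
      exists_colimitsOfShape X := by
        obtain ⟨J, _, _, ⟨h⟩⟩ := exists_colimitsOfShape_acyclicInLim hA hS X.property
        refine ⟨J, inferInstance, inferInstance, ⟨?_⟩⟩
        let D : J ⥤ (acyclicInLim S).FullSubcategory :=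
          (acyclicInLim S).lift h.diag fun j => (h.prop_diag_obj j).1
        let c : Cocone D :=
          { pt := X
            ι := { app j := ObjectProperty.homMk (h.ι.app j)
                   naturality j k a := by
                    ext : 1
                    exact h.ι.naturality a } }
        have hc : IsColimit c :=
          isColimitOfReflects (acyclicInLim S).ι (IsColimit.ofIsoColimit h.isColimit
            (Cocone.ext (Iso.refl _)))
        exact { diag := D, ι := c.ι, isColimit := hc, prop_diag_obj j := (h.prop_diag_obj j).2 } }
  refine ⟨?_, fun T => ⟨fun hT n => ?_, fun hT => ?_⟩, fun C hC => ?_⟩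
  · have : ObjectProperty.EssentiallySmall.{u} P :=
      essentiallySmall_inverseImage_ι _ (isCardinalPresentable _ (Cardinal.aleph.{u} 1))
    have h1 := hgen.hasCardinalFilteredGenerator
    have h2 : HasCardinalFilteredColimits (acyclicInLim S).FullSubcategory
        (Cardinal.aleph.{u} 1) :=
      { hasColimitsOfShape J _ _ := by
          have := hclosed J
          infer_instance }
    exact { }
  · have hT' : isCardinalPresentable _ (Cardinal.aleph.{u} 1) T := hT
    -- Presentability inside the class does not directly give it for the underlying complex; the
    -- passage is through a retract of a member of the generator `P`.
    rw [hgen.isPresentable_eq_retractClosure] at hT'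
    obtain ⟨T', hT', ⟨r⟩⟩ := hT'
    have : IsCardinalPresentable T'.obj (Cardinal.aleph.{u} 1) := hT'
    have r' : Retract T.obj T'.obj := r.map (acyclicInLim S).ι
    exact isCardinalPresentable_X _ (r'.isCardinalPresentable (Cardinal.aleph.{u} 1)) n
  · exact hPle _ (isCountablyPresentable_of_X _ hT)
  · rw [directedColimits_iff]
    obtain ⟨J, _, _, h⟩ := exists_colimitsOfShape_acyclicInLim hA hS hC
    refine ⟨J, inferInstance, inferInstance, ObjectProperty.colimitsOfShape_monotone J ?_ _ h⟩
    exact fun T hT => ⟨hT.1, isCardinalPresentable_X T hT.2⟩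

/-- Right ideals of `R` correspond to left ideals of `Rᵐᵒᵖ` because `op` identifies `R` with `Rᵐᵒᵖ`
as `Rᵐᵒᵖ`-modules. -/
lemma isCountablyCoherent_of_isRightCountablyCoherent {R : Type u} [Ring R]
    (hR : IsRightCountablyCoherent R) : IsCountablyCoherent Rᵐᵒᵖ Rᵐᵒᵖ := by
  refine .of_isCountablyRelated_ideal fun I hI => ?_
  let e : Rᵐᵒᵖ ≃ₗ[Rᵐᵒᵖ] R :=
    { MulOpposite.opAddEquiv.symm with
      map_smul' := fun a b => rfl }
  have h := hR (I.map e.toLinearMap) (hI.map _)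
  exact (isCountablyRelated_of_isCountablyPresentable _ h).of_equiv
    (e.submoduleMap I).symm

end Main

end AcyclicLim

theorem mainTheorem8 {R : Type u} [Ring R] (hR : AcyclicLim.IsRightCountablyCoherent R)
    (S : ℤ → ObjectProperty (ModuleCat.{u} Rᵐᵒᵖ))
    (hS : ∀ (n : ℤ) (M : ModuleCat.{u} Rᵐᵒᵖ), S n M → IsFinitelyPresentable.{u} M) :
    IsCardinalAccessibleCategory (AcyclicLim.acyclicWithTermsInLim S).FullSubcategory
        (Cardinal.aleph.{u} 1) ∧
      (∀ T : (AcyclicLim.acyclicWithTermsInLim S).FullSubcategory,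
        AcyclicLim.IsCountablyPresentable.{u} T ↔
          ∀ n : ℤ, AcyclicLim.IsCountablyPresentable.{u} (T.obj.X n)) ∧
      (∀ C : CochainComplex (ModuleCat.{u} Rᵐᵒᵖ) ℤ, AcyclicLim.acyclicWithTermsInLim S C →
        AcyclicLim.directedColimits (Cardinal.aleph.{u} 1)
          (fun T : CochainComplex (ModuleCat.{u} Rᵐᵒᵖ) ℤ =>
            AcyclicLim.acyclicWithTermsInLim S T ∧
              ∀ n : ℤ, AcyclicLim.IsCountablyPresentable.{u} (T.X n)) C) :=
  AcyclicLim.acyclicInLim_accessible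
    (AcyclicLim.isCountablyCoherent_of_isRightCountablyCoherent hR) hS
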